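/- Let $\Lambda\ge 1$, $\mathfrak L,B,\Gamma\ge 0$, $M,d\in\mathbb R$, and let $\varpi$ be a real function with $\varpi(t)\to 0$ as $t\to 0^+$. Then there exist constants $C^{(0)}$ and $C^{(1)}$, depending only on $\varpi,\Lambda,\mathfrak L,B,\Gamma,M$ and $d$, with the following property. Let $D\subset\mathbb C$ be a bounded domain (non-empty, open and connected) of diameter $d$. Let $A(z)=(a^{ij}(z))_{i,j=1}^2$ be real symmetric matrices, $z\in D$, with $$\Lambda^{-1}\le\sum_{i,j=1}^2 a^{ij}(z)h_ih_j\le\Lambda\quad\text{for } z\in D,\ h_1^2+h_2^2=1,\qquad |A(z)-A(\zeta)|\le\mathfrak L|\zeta-z|\quad\text{for } z,\zeta\in D,$$ where $|A|=\max\{|Ah|:h\in\mathbb R^2,|h|=1\}$. Let $u$ be a real- or complex-valued $C^2$ function on $D$ with $$\Big|\sum_{i,j=1}^2 a^{ij}(z)D_{ij}u(z)\Big|\le B|\nabla u(z)|^2+\Gamma,\qquad |u(z)|\le M\qquad(z\in D),$$ where $|\nabla u|$ denotes the operator norm of the real derivative of $u$ (the Euclidean length of the gradient if $u$ is real-valued),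 and suppose that $u$ has modulus of continuity $\varpi$ in $D$, that is, $|u(z)-u(w)|\le\varpi(|z-w|)$ for all distinct $z,w\in D$. Then for every $z\in D$ $$|\nabla u(z)|<C^{(0)}\rho(z)^{-1}\sup_{\zeta\in D,\ |\zeta-z|\le\rho(z)}|u(\zeta)|+C^{(1)},\qquad \rho(z)=\mathrm{dist}(z,\partial D).$$ The supremum equals the maximum of $|u|$ over the closed disk $|\zeta-z|\le\rho(z)$ when $u$ is extended continuously to $\overline D$ (the extension exists because $u$ is uniformly continuous). -/

import Mathlib

open Set Filter Topology Metric

noncomputable section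

namespace EllipticPlane

/-- The standard orthonormal basis `(1, i)` of the plane `ℂ = ℝ²`. -/
def e : Fin 2 → ℂ := ![1, Complex.I]

variable {𝕜 : Type*} [RCLike 𝕜]

/-- The second order partial derivative `D_{ij} u (z)` with respect to the real coordinates
`x = Re z`, `y = Im z`. -/
def secondPartial (u : ℂ → 𝕜) (i j : Fin 2) (z : ℂ) : 𝕜 :=
  fderiv ℝ (fun w => fderiv ℝ u w (e j)) z (e i)

/-- The operator `L[u](z) = ∑_{i,j} a^{ij}(z) D_{ij} u(z)`. -/
def ellipticOp (A : ℂ → Matrix (Fin 2) (Fin 2) ℝ) (u : ℂ → 𝕜) (z : ℂ) : 𝕜 :=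
  ∑ i, ∑ j, A z i j • secondPartial u i j z

/-- The norm of the (Fréchet) gradient: the operator norm of the real derivative of `u` at `z`.
For real valued `u` it is the Euclidean length of `(u_x, u_y)`; for complex valued `u` it is the
operator norm of the Jacobian matrix. -/
def gradNorm (u : ℂ → 𝕜) (z : ℂ) : ℝ := ‖fderiv ℝ u z‖

/-- The matrix norm `|A| = max {|A h| : |h| = 1}` for the Euclidean length. -/
def matNorm (A : Matrix (Fin 2) (Fin 2) ℝ) : ℝ := ‖Matrix.toEuclideanCLM (𝕜 := ℝ) A‖

/-- Symmetric coefficients on `D`, uniformly elliptic with constant `Λ` and Lipschitz with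
constant `𝔏`. -/
structure IsEllipticLipschitz (D : Set ℂ) (A : ℂ → Matrix (Fin 2) (Fin 2) ℝ) (Λ 𝔏 : ℝ) :
    Prop where
  symm : ∀ z ∈ D, (A z).IsSymm
  elliptic : ∀ z ∈ D, ∀ h : Fin 2 → ℝ, ∑ i, h i ^ 2 = 1 →
    Λ⁻¹ ≤ ∑ i, ∑ j, A z i j * h i * h j ∧ ∑ i, ∑ j, A z i j * h i * h j ≤ Λ
  lipschitz : ∀ z ∈ D, ∀ ζ ∈ D, matNorm (A z - A ζ) ≤ 𝔏 * ‖ζ - z‖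

/-- `u` is a `C²` solution in `D` of `|L[u]| ≤ B |∇u|² + Γ`. -/
structure IsSolution (D : Set ℂ) (A : ℂ → Matrix (Fin 2) (Fin 2) ℝ) (B Γ : ℝ) (u : ℂ → 𝕜) :
    Prop where
  contDiffOn : ContDiffOn ℝ 2 u D
  ineq : ∀ z ∈ D, ‖ellipticOp A u z‖ ≤ B * gradNorm u z ^ 2 + Γ

/-- `ω` is a modulus of continuity of `u` on `D`: `ω(t) → 0` as `t → 0+`, and
`|u(z) - u(w)| ≤ ω(|z - w|)` for distinct `z, w ∈ D`. -/
structure IsModulusOfContinuity (D : Set ℂ) (u : ℂ → 𝕜) (ω : ℝ → ℝ) : Prop where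
  tendsto : Tendsto ω (𝓝[>] 0) (𝓝 0)
  bound : ∀ z ∈ D, ∀ w ∈ D, z ≠ w → ‖u z - u w‖ ≤ ω ‖z - w‖

/-- The distance `ρ(z) = dist(z, ∂D)`. -/
def bdryDist (D : Set ℂ) (z : ℂ) : ℝ := infDist z (frontier D)

/-- The supremum of `|u(ζ)|` over the points `ζ` of `D` with `|ζ - z| ≤ ρ(z)`. When `u` is
uniformly continuous on `D`, it is the maximum over the closed disk `|ζ - z| ≤ ρ(z)` of the
continuous extension of `|u|` to the closure of `D`. -/
def diskSup (D : Set ℂ) (u : ℂ → 𝕜) (z : ℂ) : ℝ :=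
  sSup ((fun ζ => ‖u ζ‖) '' {ζ ∈ D | ‖ζ - z‖ ≤ bdryDist D z})

end EllipticPlane

end

noncomputable section

namespace EllipticPlane

open MeasureTheory

/-! The core is an interior bound for `∇v(c)` that uses only the oscillation `m` of `v` on a disk of
radius `R`, a bound `G` for `|∇v|` and a bound `S` for `|L[v]|`: `|∇v(c)| ≤ C (m/R + R (S + 𝔏 G))`.
Consider `N(t) = ∫ φ(y) ∂ₖv(c + t y) dy`. Integration by parts at `t ~ R` bounds `N(t)` by `m/R`,
while `N(0)` is `∂ₖv(c) ∫ φ`. In `N'(t)` the field `φ(y) y` equals `A(c) g` with `g` curl free; two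
integrations by parts swap indices and turn the integrand into `gₖ` times the operator with
coefficients frozen at `c` (`integral_radial`). The error of freezing is integrated by parts once
more: its coefficient has Lipschitz constant `O(𝔏 t)`, which pays for the factor `1/t`, so only `∇v`
appears (`abs_integral_radial_le`).

For the quadratic inequality, take a maximum `Q` of `(r - |z - z₀|) |∇u(z)|` over a small disk.
Around the maximum point `|∇u|` at most doubles, so the linear estimate on a proportion `t` of the
distance to the circle gives `Q ≤ C (m/t + t (Γ r² + 4 B Q² + 2 𝔏 Q))`. Small oscillation, supplied
by the modulus of continuity, with `t = δ/Q` excludes `Q > 1`; then `Q² ≤ Q`, the inequality is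
linear, and `t = δ` yields the bound by the supremum of `|u|` (`le_of_quadratic_estimate`). -/

/-! ### Weights adapted to a constant elliptic matrix -/

/-- A `C¹` cut-off `φ` and functions `g 0, g 1`, all supported in a fixed disk, such that the
vector field `y ↦ φ y • y` equals `A₀ g`, where `g` is curl free. All sizes are controlled by the
single constant `K`. -/
structure IsAdaptedWeight (A₀ : Matrix (Fin 2) (Fin 2) ℝ) (K : ℝ) (φ : ℂ → ℝ)
    (g : Fin 2 → ℂ → ℝ) : Prop where
  contDiff : ContDiff ℝ 1 φ
  support : ∀ y, y ∉ closedBall (0 : ℂ) K → φ y = 0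
  norm_fderiv_le : ∀ y, ‖fderiv ℝ φ y‖ ≤ K
  inv_le_integral : K⁻¹ ≤ ∫ y, φ y
  contDiff_field : ∀ i, ContDiff ℝ 1 (g i)
  support_field : ∀ i y, y ∉ closedBall (0 : ℂ) K → g i y = 0
  abs_field_le : ∀ i y, |g i y| ≤ K
  norm_fderiv_field_le : ∀ i y, ‖fderiv ℝ (g i) y‖ ≤ K
  curl_free : ∀ i k y, fderiv ℝ (g i) y (e k) = fderiv ℝ (g k) y (e i)
  radial : ∀ j y, φ y * inner ℝ y (e j) = ∑ i, A₀ i j * g i y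

/-- The inverse of an elliptic symmetric matrix, as an operator on the plane. -/
lemma exists_inverse_operator {A₀ : Matrix (Fin 2) (Fin 2) ℝ} {Λ : ℝ} (hΛ : 1 ≤ Λ)
    (hs : A₀.IsSymm)
    (he : ∀ h : Fin 2 → ℝ, ∑ i, h i ^ 2 = 1 →
      Λ⁻¹ ≤ ∑ i, ∑ j, A₀ i j * h i * h j ∧ ∑ i, ∑ j, A₀ i j * h i * h j ≤ Λ) :
    ∃ T : ℂ →L[ℝ] ℂ, (∀ x y, inner ℝ (T x) y = inner ℝ (T y) x) ∧
      (∀ y j, ∑ i, A₀ i j * inner ℝ (T y) (e i) = inner ℝ y (e j)) ∧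
      (∀ y, ‖T y‖ ≤ Λ * ‖y‖) ∧ (∀ y, ‖y‖ ^ 2 ≤ 4 * Λ ^ 3 * inner ℝ (T y) y) := by
  have hΛ0 : 0 < Λ := by linarith
  have h10 : A₀ 1 0 = A₀ 0 1 := hs.apply 0 1
  obtain ⟨a, ha⟩ : ∃ a, A₀ 0 0 = a := ⟨_, rfl⟩
  obtain ⟨b, hb⟩ : ∃ b, A₀ 0 1 = b := ⟨_, rfl⟩
  obtain ⟨c, hc⟩ : ∃ c, A₀ 1 1 = c := ⟨_, rfl⟩
  rw [hb] at h10
  have key : ∀ x y : ℝ, Λ⁻¹ * (x ^ 2 + y ^ 2) ≤ a * x ^ 2 + 2 * b * x * y + c * y ^ 2 ∧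
      a * x ^ 2 + 2 * b * x * y + c * y ^ 2 ≤ Λ * (x ^ 2 + y ^ 2) := by
    intro x y
    rcases (by positivity : 0 ≤ x ^ 2 + y ^ 2).eq_or_lt with h0 | h0
    · have hx : x = 0 := by nlinarith [sq_nonneg x, sq_nonneg y]
      have hy : y = 0 := by nlinarith [sq_nonneg x, sq_nonneg y]
      simp [hx, hy]
    · set s := Real.sqrt (x ^ 2 + y ^ 2)
      have hs2 : s ^ 2 = x ^ 2 + y ^ 2 := Real.sq_sqrt h0.le
      have hs0 : 0 < s := Real.sqrt_pos.2 h0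
      have h := he ![x / s, y / s] (by
        simp only [Fin.sum_univ_two, Matrix.cons_val_zero, Matrix.cons_val_one, div_pow]
        rw [← add_div, hs2, div_self h0.ne'])
      simp only [Fin.sum_univ_two, Matrix.cons_val_zero, Matrix.cons_val_one, ha, hb, hc, h10] at h
      have e1 : a * (x / s) * (x / s) + b * (x / s) * (y / s) +
          (b * (y / s) * (x / s) + c * (y / s) * (y / s)) =
          (a * x ^ 2 + 2 * b * x * y + c * y ^ 2) / s ^ 2 := by
        field_simp; ring
      rw [e1, hs2, le_div_iff₀ h0, div_le_iff₀ h0] at h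
      exact h
  have hΛi : 0 < Λ⁻¹ := inv_pos.2 hΛ0
  have ha1 := key 1 0
  have hc1 := key 0 1
  have hp := key 1 1
  have hm := key 1 (-1)
  norm_num at ha1 hc1 hp hm
  have hapos : 0 < a := by linarith
  have hdet : 0 < a * c - b ^ 2 := by
    -- At `(b, -a)` the quadratic form equals `a (a c - b²)`.
    have h := (key b (-a)).1
    have : 0 < Λ⁻¹ * (b ^ 2 + (-a) ^ 2) := mul_pos hΛi (by nlinarith [sq_nonneg b])
    by_contra hcon
    nlinarith
  obtain ⟨m, hmdef⟩ : ∃ m, a * c - b ^ 2 = m := ⟨_, rfl⟩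
  rw [hmdef] at hdet
  let T : ℂ →L[ℝ] ℂ := Complex.reCLM.smulRight (⟨c / m, -b / m⟩ : ℂ) +
    Complex.imCLM.smulRight (⟨-b / m, a / m⟩ : ℂ)
  have hre : ∀ y, (T y).re = (c * y.re - b * y.im) / m := fun y => by
    simp [T]; ring
  have him : ∀ y, (T y).im = (-b * y.re + a * y.im) / m := fun y => by
    simp [T]; ring
  have hinner : ∀ x y : ℂ, inner ℝ x y = x.re * y.re + x.im * y.im := fun x y => by
    rw [Complex.inner]; simp; ring
  have hback : ∀ y, y.re = a * (T y).re + b * (T y).im ∧ y.im = b * (T y).re + c * (T y).im := by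
    intro y
    rw [hre, him]
    constructor <;> (field_simp; rw [← hmdef]; ring)
  have hnorm : ∀ y : ℂ, ‖y‖ ^ 2 = y.re ^ 2 + y.im ^ 2 := fun y => by
    rw [Complex.sq_norm, Complex.normSq_apply]; ring
  -- Lower ellipticity at the vector `T y`, where the form is `⟨A₀ T y, T y⟩ = ⟨y, T y⟩`.
  have hq : ∀ y, ‖T y‖ ^ 2 ≤ Λ * inner ℝ (T y) y := by
    intro y
    have h := (key (T y).re (T y).im).1
    have h2 : inner ℝ (T y) y =
        a * (T y).re ^ 2 + 2 * b * (T y).re * (T y).im + c * (T y).im ^ 2 := by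
      rw [hinner]
      linear_combination (T y).re * (hback y).1 + (T y).im * (hback y).2
    rw [← h2, ← hnorm, inv_mul_le_iff₀ hΛ0] at h
    exact h
  refine ⟨T, ?_, ?_, ?_, ?_⟩
  · intro x y
    rw [hinner, hinner, hre, hre, him, him]; ring
  · intro y j
    have h := hback y
    fin_cases j
    · simp [e, hinner, Fin.sum_univ_two, ha, h10]; linarith [h.1]
    · simp [e, hinner, Fin.sum_univ_two, hb, hc]; linarith [h.2]
  · intro y
    have h1 := hq y
    have h2 := real_inner_le_norm (T y) y
    rcases (norm_nonneg (T y)).eq_or_lt with h0 | h0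
    · rw [← h0]; positivity
    · have : ‖T y‖ * ‖T y‖ ≤ ‖T y‖ * (Λ * ‖y‖) := by nlinarith
      exact le_of_mul_le_mul_left this h0
  · intro y
    have h1 := hq y
    have hbb : b ^ 2 ≤ Λ ^ 2 := by
      apply sq_le_sq'
      · linarith
      · linarith
    have haa : a ^ 2 ≤ Λ ^ 2 := by apply sq_le_sq' <;> linarith
    have hcc : c ^ 2 ≤ Λ ^ 2 := by apply sq_le_sq' <;> linarith
    have h3 : ‖y‖ ^ 2 ≤ 4 * Λ ^ 2 * ‖T y‖ ^ 2 := by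
      rw [hnorm, hnorm, (hback y).1, (hback y).2]
      set p := (T y).re
      set q := (T y).im
      nlinarith [sq_nonneg (a * p - b * q), sq_nonneg (b * p - c * q),
        mul_le_mul_of_nonneg_right haa (sq_nonneg p), mul_le_mul_of_nonneg_right hbb (sq_nonneg p),
        mul_le_mul_of_nonneg_right hbb (sq_nonneg q), mul_le_mul_of_nonneg_right hcc (sq_nonneg q)]
    calc ‖y‖ ^ 2 ≤ 4 * Λ ^ 2 * ‖T y‖ ^ 2 := h3
      _ ≤ 4 * Λ ^ 2 * (Λ * inner ℝ (T y) y) := by gcongr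
      _ = _ := by ring

lemma hasFDerivAt_quadratic {T : ℂ →L[ℝ] ℂ} (hT : ∀ x y, inner ℝ (T x) y = inner ℝ (T y) x)
    (y : ℂ) : HasFDerivAt (fun y => inner ℝ (T y) y) ((2 : ℝ) • innerSL ℝ (T y)) y := by
  have h := (T.hasFDerivAt (x := y)).inner ℝ (hasFDerivAt_id (𝕜 := ℝ) y)
  refine h.congr_fderiv ?_
  ext v
  simp [hT]; ring

/-- Adapted weights exist, with a constant depending on the ellipticity only. -/
lemma exists_isAdaptedWeight {Λ : ℝ} (hΛ : 1 ≤ Λ) :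
    ∃ K : ℝ, 0 < K ∧ ∀ A₀ : Matrix (Fin 2) (Fin 2) ℝ, A₀.IsSymm →
      (∀ h : Fin 2 → ℝ, ∑ i, h i ^ 2 = 1 →
        Λ⁻¹ ≤ ∑ i, ∑ j, A₀ i j * h i * h j ∧ ∑ i, ∑ j, A₀ i j * h i * h j ≤ Λ) →
      ∃ φ g, IsAdaptedWeight A₀ K φ g := by
  have hΛ0 : 0 < Λ := by linarith
  let f : ContDiffBump (0 : ℝ) := ⟨1 / 2, 1, by norm_num, by norm_num⟩
  have hf0 : ∀ s, 0 ≤ f s := fun s => f.nonneg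
  have hf1 : ∀ s, f s ≤ 1 := fun s => f.le_one
  have hfs : ∀ s, 1 < s → f s = 0 := fun s hs => f.zero_of_le_dist (by
    rw [Real.dist_eq, sub_zero, abs_of_pos (by linarith)]; exact hs.le)
  have hfone : ∀ s, |s| ≤ 1 / 2 → f s = 1 := fun s hs => f.one_of_mem_closedBall (by
    rw [mem_closedBall, Real.dist_eq, sub_zero]; exact hs)
  have hfc : ContDiff ℝ 2 f := f.contDiff
  have hfd : ∀ s, HasDerivAt f (deriv f s) s := fun s =>
    (hfc.differentiable (by norm_num) s).hasDerivAt
  have hds : ∀ s, 1 < s → deriv f s = 0 := fun s hs => by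
    have : f =ᶠ[𝓝 s] fun _ => (0 : ℝ) := by
      filter_upwards [lt_mem_nhds hs] with t ht using hfs t ht
    rw [this.deriv_eq]; simp
  have hfdc : Continuous (deriv f) := hfc.continuous_deriv (by norm_num)
  obtain ⟨F, hF⟩ := hfdc.bounded_above_of_compact_support f.hasCompactSupport.deriv
  have hF0 : 0 ≤ F := (norm_nonneg _).trans (hF 0)
  -- If `‖y‖ > r`, then `r ⟨T y, y⟩ ≥ ‖y‖² > r² ≥ r`, so `f` vanishes at `⟨T y, y⟩`.
  set r : ℝ := 4 * Λ ^ 3 with hr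
  have hr1 : 1 ≤ r := by nlinarith [one_le_pow₀ hΛ (n := 3)]
  -- On this disk `⟨T y, y⟩ ≤ Λ ‖y‖² ≤ 1/2`, hence `φ = 1` there and `I ≤ ∫ φ`.
  set I : ℝ := volume.real (closedBall (0 : ℂ) (1 / (2 * Λ))) with hI
  have hIpos : 0 < I := by
    refine ENNReal.toReal_pos (measure_closedBall_pos _ _ (by positivity)).ne' ?_
    exact measure_closedBall_lt_top.ne
  set K : ℝ := max (max r (F * (2 * (Λ * r)))) (max (max (Λ * r)
    (F * (2 * (Λ * r)) * (Λ * r) + Λ)) I⁻¹) with hK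
  have hKr : r ≤ K := (le_max_left _ _).trans (le_max_left _ _)
  have hKφ : F * (2 * (Λ * r)) ≤ K := (le_max_right _ _).trans (le_max_left _ _)
  have hKg : Λ * r ≤ K := ((le_max_left _ _).trans (le_max_left _ _)).trans (le_max_right _ _)
  have hKd : F * (2 * (Λ * r)) * (Λ * r) + Λ ≤ K :=
    ((le_max_right _ _).trans (le_max_left _ _)).trans (le_max_right _ _)
  have hKI : I⁻¹ ≤ K := (le_max_right _ _).trans (le_max_right _ _)
  have hK0 : 0 < K := by linarith
  refine ⟨K, hK0, fun A₀ hs he => ?_⟩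
  obtain ⟨T, hT, hTA, hTn, hTc⟩ := exists_inverse_operator hΛ hs he
  have hq : ∀ y, HasFDerivAt (fun y => inner ℝ (T y) y) ((2 : ℝ) • innerSL ℝ (T y)) y :=
    hasFDerivAt_quadratic hT
  have hout : ∀ y, r < ‖y‖ → 1 < inner ℝ (T y) y := by
    intro y hy
    have h := hTc y
    rw [← hr] at h
    have : r * r < ‖y‖ ^ 2 := by nlinarith
    have : r * 1 ≤ r * r := by gcongr
    exact lt_of_mul_lt_mul_left (a := r) (by linarith) (by linarith)
  set φ : ℂ → ℝ := fun y => f (inner ℝ (T y) y) with hφ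
  -- The field `f(⟨T y, y⟩) T y` is the gradient of a function of `⟨T y, y⟩`, since `T` is
  -- symmetric; this is why it is curl free.
  set g : Fin 2 → ℂ → ℝ := fun i y => φ y * inner ℝ (T y) (e i) with hg
  have hφc : ContDiff ℝ 1 φ := by
    have : ContDiff ℝ 1 f := f.contDiff
    exact this.comp (T.contDiff.inner ℝ contDiff_id)
  have hφd : ∀ y, HasFDerivAt φ (deriv f (inner ℝ (T y) y) • (2 : ℝ) • innerSL ℝ (T y)) y :=
    fun y => (hfd _).comp_hasFDerivAt y (hq y)
  have hgd : ∀ i y, HasFDerivAt (g i)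
      (φ y • ((innerSL ℝ (e i)).comp T) + inner ℝ (T y) (e i) •
        (deriv f (inner ℝ (T y) y) • (2 : ℝ) • innerSL ℝ (T y))) y := by
    intro i y
    have h1 : HasFDerivAt (fun y => inner ℝ (T y) (e i)) ((innerSL ℝ (e i)).comp T) y := by
      have := ((innerSL ℝ (e i)).comp T).hasFDerivAt (x := y)
      refine this.congr_of_eventuallyEq (Eventually.of_forall fun y => ?_)
      simp [real_inner_comm]
    exact (hφd y).mul h1
  have he1 : ∀ i, ‖e i‖ = 1 := fun i => by fin_cases i <;> simp [e]
  have hin : ∀ y v, ‖y‖ ≤ r → |inner ℝ (T y) v| ≤ Λ * r * ‖v‖ := by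
    intro y v hy
    calc |inner ℝ (T y) v| ≤ ‖T y‖ * ‖v‖ := abs_real_inner_le_norm _ _
      _ ≤ Λ * r * ‖v‖ := by gcongr; exact (hTn y).trans (by gcongr)
  have hφ0 : ∀ y, r < ‖y‖ → φ y = 0 := fun y hy => hfs _ (hout y hy)
  have hφabs : ∀ y, |φ y| ≤ 1 := fun y => by rw [abs_of_nonneg (hf0 _)]; exact hf1 _
  have hDφ : ∀ y v, |deriv f (inner ℝ (T y) y) * (2 * inner ℝ (T y) v)| ≤
      F * (2 * (Λ * r)) * ‖v‖ := by
    intro y v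
    rcases le_or_gt ‖y‖ r with hy | hy
    · rw [abs_mul, abs_mul, abs_two]
      calc _ ≤ F * (2 * (Λ * r * ‖v‖)) := by
            gcongr
            · exact hF _
            · exact hin y v hy
        _ = _ := by ring
    · rw [hds _ (hout y hy)]; simp; positivity
  have hball : ∀ y, y ∉ closedBall (0 : ℂ) K → r < ‖y‖ := by
    intro y hy
    rw [mem_closedBall, dist_zero_right, not_le] at hy
    linarith
  refine ⟨φ, g, hφc, fun y hy => hφ0 y (hball y hy), ?_, ?_, ?_, ?_, ?_, ?_, ?_, ?_⟩
  · intro y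
    rw [(hφd y).fderiv]
    refine ContinuousLinearMap.opNorm_le_bound _ hK0.le fun v => ?_
    have := hDφ y v
    simp only [smul_apply, innerSL_apply_apply, smul_eq_mul, Real.norm_eq_abs]
    exact this.trans (by gcongr)
  · have hint : Integrable φ := by
      refine hφc.continuous.integrable_of_hasCompactSupport ?_
      exact HasCompactSupport.intro (isCompact_closedBall (0 : ℂ) K)
        fun y hy => hφ0 y (hball y hy)
    calc K⁻¹ ≤ I := inv_le_of_inv_le₀ hIpos hKI
      _ = ∫ y in closedBall (0 : ℂ) (1 / (2 * Λ)), (1 : ℝ) := by simp [hI]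
      _ = ∫ y in closedBall (0 : ℂ) (1 / (2 * Λ)), φ y := by
        refine setIntegral_congr_fun measurableSet_closedBall fun y hy => ?_
        rw [mem_closedBall, dist_zero_right] at hy
        refine (hfone _ ?_).symm
        calc |inner ℝ (T y) y| ≤ ‖T y‖ * ‖y‖ := abs_real_inner_le_norm _ _
          _ ≤ Λ * ‖y‖ * ‖y‖ := by gcongr; exact hTn y
          _ ≤ Λ * (1 / (2 * Λ)) * (1 / (2 * Λ)) := by gcongr
          _ = 1 / 2 * (1 / (2 * Λ)) := by field_simp
          _ ≤ 1 / 2 * 1 := by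
            gcongr; rw [div_le_one (by positivity)]; linarith
          _ = 1 / 2 := by ring
      _ ≤ ∫ y, φ y := setIntegral_le_integral hint (Eventually.of_forall fun y => hf0 _)
  · intro i
    exact hφc.mul (T.contDiff.inner ℝ contDiff_const)
  · intro i y hy
    simp [hg, hφ0 y (hball y hy)]
  · intro i y
    rcases le_or_gt ‖y‖ r with hy | hy
    · rw [hg, abs_mul]
      have := hin y (e i) hy
      rw [he1, mul_one] at this
      calc _ ≤ 1 * (Λ * r) := by gcongr; exact hφabs y
        _ ≤ K := by linarith
    · simp [hg, hφ0 y hy, hK0.le]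
  · intro i y
    rw [(hgd i y).fderiv]
    refine ContinuousLinearMap.opNorm_le_bound _ hK0.le fun v => ?_
    simp only [add_apply, smul_apply, innerSL_apply_apply,
      smul_eq_mul, Real.norm_eq_abs, ContinuousLinearMap.comp_apply]
    refine (?_ : _ ≤ (F * (2 * (Λ * r)) * (Λ * r) + Λ) * ‖v‖).trans (by gcongr)
    have h1 : |φ y * inner ℝ (e i) (T v)| ≤ Λ * ‖v‖ := by
      rw [abs_mul]
      calc _ ≤ 1 * (‖e i‖ * ‖T v‖) := by
            gcongr
            · exact hφabs y
            · exact abs_real_inner_le_norm _ _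
        _ ≤ _ := by rw [he1]; simpa using hTn v
    have h2 : |inner ℝ (T y) (e i) * (deriv f (inner ℝ (T y) y) * (2 * inner ℝ (T y) v))| ≤
        Λ * r * (F * (2 * (Λ * r)) * ‖v‖) := by
      rcases le_or_gt ‖y‖ r with hy | hy
      · rw [abs_mul]
        have h3 := hin y (e i) hy
        rw [he1, mul_one] at h3
        exact mul_le_mul h3 (hDφ y v) (abs_nonneg _) (by positivity)
      · rw [hds _ (hout y hy)]; simp; positivity
    calc _ ≤ _ := abs_add_le _ _
      _ ≤ Λ * ‖v‖ + Λ * r * (F * (2 * (Λ * r)) * ‖v‖) := add_le_add h1 h2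
      _ = _ := by ring
  · intro i k y
    rw [(hgd i y).fderiv, (hgd k y).fderiv]
    simp only [add_apply, smul_apply, innerSL_apply_apply,
      smul_eq_mul, ContinuousLinearMap.comp_apply]
    rw [real_inner_comm, hT (e k) (e i), real_inner_comm (e k)]
    ring
  · intro j y
    rw [← hTA y j, Finset.mul_sum]
    refine Finset.sum_congr rfl fun i _ => ?_
    simp only [hg]; ring

/-! ### Integration by parts on a disk, with Lipschitz factors -/

lemma hasCompactSupport_of_closedBall {f : ℂ → ℝ} {K : ℝ}
    (hf : ∀ y, y ∉ closedBall (0 : ℂ) K → f y = 0) : HasCompactSupport f :=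
  HasCompactSupport.intro (isCompact_closedBall (0 : ℂ) K) hf

lemma abs_integral_le_of_closedBall {f : ℂ → ℝ} {K C : ℝ}
    (hf : ∀ y, y ∉ closedBall (0 : ℂ) K → f y = 0) (hC : ∀ y ∈ closedBall (0 : ℂ) K, |f y| ≤ C) :
    |∫ y, f y| ≤ C * volume.real (closedBall (0 : ℂ) K) := by
  rw [← setIntegral_eq_integral_of_forall_compl_eq_zero hf]
  exact norm_setIntegral_le_of_norm_le_const (f := f) measure_closedBall_lt_top hC

lemma integral_mul_fderiv_of_closedBall {f w : ℂ → ℝ} {K : ℝ}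
    (hf : ∀ y, y ∉ closedBall (0 : ℂ) K → f y = 0) (hfc : ContDiff ℝ 1 f) (hw : ContDiff ℝ 1 w)
    (v : ℂ) : ∫ y, f y * fderiv ℝ w y v = -∫ y, fderiv ℝ f y v * w y := by
  have hs := hasCompactSupport_of_closedBall hf
  have hfd : Continuous fun y => fderiv ℝ f y v := (hfc.continuous_fderiv one_ne_zero).clm_apply
    continuous_const
  have hwd : Continuous fun y => fderiv ℝ w y v := (hw.continuous_fderiv one_ne_zero).clm_apply
    continuous_const
  refine integral_mul_fderiv_eq_neg_fderiv_mul_of_integrable ?_ ?_ ?_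
    (fun x _ => hfc.differentiable one_ne_zero x) (fun x _ => hw.differentiable one_ne_zero x)
  · exact (hfd.mul hw.continuous).integrable_of_hasCompactSupport (hs.fderiv_apply ℝ v).mul_right
  · exact (hfc.continuous.mul hwd).integrable_of_hasCompactSupport hs.mul_right
  · exact (hfc.continuous.mul hw.continuous).integrable_of_hasCompactSupport hs.mul_right

/-- Integration by parts against a Lipschitz function. -/
lemma abs_integral_mul_fderiv_le {f w : ℂ → ℝ} {K G : ℝ} {ℓ : NNReal}
    (hf : ∀ y, y ∉ closedBall (0 : ℂ) K → f y = 0) (hfl : LipschitzWith ℓ f)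
    (hw : ContDiff ℝ 1 w) (hws : HasCompactSupport w)
    (hG : ∀ y ∈ closedBall (0 : ℂ) K, |w y| ≤ G) (v : ℂ) :
    |∫ y, f y * fderiv ℝ w y v| ≤ ℓ * ‖v‖ * G * volume.real (closedBall (0 : ℂ) K) := by
  have hs := hasCompactSupport_of_closedBall hf
  obtain ⟨C, hC⟩ := hw.lipschitzWith_of_hasCompactSupport hws one_ne_zero
  -- As `f` is only Lipschitz, its derivative is taken as a line derivative; the sign of the
  -- integration by parts sits in the direction `-v`.
  have h1 : ∫ y, f y * fderiv ℝ w y v = ∫ y, lineDeriv ℝ f y (-v) * w y := by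
    rw [← hC.integral_lineDeriv_mul_eq hfl hs v]
    refine integral_congr_ae (Eventually.of_forall fun y => ?_)
    simp only
    rw [(hw.differentiable one_ne_zero y).lineDeriv_eq_fderiv, mul_comm]
  rw [h1]
  refine abs_integral_le_of_closedBall (fun y hy => ?_) fun y hy => ?_
  · have h0 : HasLineDerivAt ℝ f 0 y (-v) := by
      have : f =ᶠ[𝓝 y] fun _ => (0 : ℝ) := by
        filter_upwards [isClosed_closedBall.isOpen_compl.mem_nhds hy] with z hz using hf z hz
      have h2 := (hasFDerivAt_const (0 : ℝ) y).congr_of_eventuallyEq (𝕜 := ℝ) this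
      simpa using h2.hasLineDerivAt (-v)
    rw [h0.lineDeriv, zero_mul]
  · rw [abs_mul]
    have h2 : ‖lineDeriv ℝ f y (-v)‖ ≤ ℓ * ‖-v‖ := norm_lineDeriv_le_of_lipschitz ℝ hfl
    rw [norm_neg] at h2
    exact mul_le_mul h2 (hG y hy) (abs_nonneg _) (by positivity)

lemma abs_entry_le_matNorm (A : Matrix (Fin 2) (Fin 2) ℝ) (i j : Fin 2) :
    |A i j| ≤ matNorm A := by
  have h := (Matrix.toEuclideanCLM (𝕜 := ℝ) A).le_opNorm (EuclideanSpace.single j 1)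
  have h2 : (Matrix.toEuclideanCLM (𝕜 := ℝ) A (EuclideanSpace.single j 1)) i = A i j := by
    simp
  have h3 := PiLp.norm_apply_le (Matrix.toEuclideanCLM (𝕜 := ℝ) A (EuclideanSpace.single j 1)) i
  rw [h2] at h3
  simp only [PiLp.norm_single, norm_one, mul_one] at h
  exact h3.trans h

/-- The product of a Lipschitz function supported in a disk and a function that is
Lipschitz on this disk. -/
lemma lipschitzWith_mul_of_closedBall {g b : ℂ → ℝ} {K L P Q : ℝ} (hP : 0 ≤ P) (hQ : 0 ≤ Q)
    (hL : 0 ≤ L)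
    (hg : ∀ y, y ∉ closedBall (0 : ℂ) K → g y = 0) (hgb : ∀ y, |g y| ≤ P)
    (hgl : ∀ y z, |g y - g z| ≤ P * ‖y - z‖)
    (hb : ∀ y ∈ closedBall (0 : ℂ) K, |b y| ≤ Q)
    (hbl : ∀ y ∈ closedBall (0 : ℂ) K, ∀ z ∈ closedBall (0 : ℂ) K, |b y - b z| ≤ L * ‖y - z‖) :
    LipschitzWith (P * (Q + L)).toNNReal (fun y => g y * b y) := by
  have hpos : 0 ≤ P * (Q + L) := by positivity
  -- Since `g z = 0`, already `|g y| ≤ P ‖y - z‖`, so nothing about `b z` is needed.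
  have hone : ∀ y ∈ closedBall (0 : ℂ) K, ∀ z ∉ closedBall (0 : ℂ) K,
      |g y * b y - g z * b z| ≤ P * (Q + L) * ‖y - z‖ := by
    intro y hy z hz
    have h := hgl y z
    rw [hg z hz, sub_zero] at h
    rw [hg z hz, zero_mul, sub_zero, abs_mul]
    calc |g y| * |b y| ≤ (P * ‖y - z‖) * Q := by gcongr; exact hb y hy
      _ ≤ (P * ‖y - z‖) * (Q + L) := by gcongr; linarith
      _ = _ := by ring
  refine LipschitzWith.of_dist_le_mul fun y z => ?_
  rw [Real.coe_toNNReal _ hpos, Real.dist_eq, dist_eq_norm]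
  by_cases hy : y ∈ closedBall (0 : ℂ) K <;> by_cases hz : z ∈ closedBall (0 : ℂ) K
  · have : g y * b y - g z * b z = (g y - g z) * b y + g z * (b y - b z) := by ring
    rw [this]
    calc _ ≤ |g y - g z| * |b y| + |g z| * |b y - b z| := by
          rw [← abs_mul, ← abs_mul]; exact abs_add_le _ _
      _ ≤ (P * ‖y - z‖) * Q + P * (L * ‖y - z‖) := by
          gcongr
          · exact hgl y z
          · exact hb y hy
          · exact hgb z
          · exact hbl y hy z hz
      _ = _ := by ring
  · exact hone y hy z hz
  · rw [abs_sub_comm, norm_sub_rev]; exact hone z hz y hy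
  · rw [hg y hy, hg z hz]; simp; positivity

/-! ### Weighted averages of a partial derivative over dilated disks -/

section Averages

variable {v : ℂ → ℝ} {c : ℂ}

lemma fderiv_comp_dilation {w : ℂ → ℝ} (hw : ContDiff ℝ 1 w) (c : ℂ) (t : ℝ) (y h : ℂ) :
    fderiv ℝ (fun y : ℂ => w (c + t • y)) y h = t * fderiv ℝ w (c + t • y) h := by
  have h1 : HasFDerivAt (fun y : ℂ => c + t • y) (t • ContinuousLinearMap.id ℝ ℂ) y :=
    ((hasFDerivAt_id y).const_smul t).const_add c
  have h2 := ((hw.differentiable one_ne_zero (c + t • y)).hasFDerivAt).comp y h1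
  have h3 : fderiv ℝ (fun y : ℂ => w (c + t • y)) y = _ := h2.fderiv
  rw [h3]
  simp

lemma contDiff_dilation {n : WithTop ℕ∞} {w : ℂ → ℝ} (hw : ContDiff ℝ n w) (c : ℂ) (t : ℝ) :
    ContDiff ℝ n (fun y : ℂ => w (c + t • y)) :=
  hw.comp (contDiff_const.add (contDiff_id.const_smul t))

lemma contDiff_partial (hv : ContDiff ℝ 2 v) (h : ℂ) :
    ContDiff ℝ 1 (fun z => fderiv ℝ v z h) :=
  (hv.fderiv_right (m := 1) (by norm_num)).clm_apply contDiff_const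

lemma secondPartial_symm (hv : ContDiff ℝ 2 v) (i j : Fin 2) (z : ℂ) :
    secondPartial v i j z = secondPartial v j i z := by
  have hd : DifferentiableAt ℝ (fderiv ℝ v) z :=
    (hv.fderiv_right (m := 1) (by norm_num)).differentiable one_ne_zero z
  have hs : IsSymmSndFDerivAt ℝ v z := hv.contDiffAt.isSymmSndFDerivAt (by simp)
  have hf : ∀ a b : ℂ, fderiv ℝ (fun w => fderiv ℝ v w a) z b = fderiv ℝ (fderiv ℝ v) z b a := by
    intro a b
    have := (hd.hasFDerivAt.clm_apply (hasFDerivAt_const a z)).fderiv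
    rw [this]; simp
  unfold secondPartial
  rw [hf, hf]
  exact hs.eq _ _

variable {A₀ : Matrix (Fin 2) (Fin 2) ℝ} {K : ℝ} {φ : ℂ → ℝ} {g : Fin 2 → ℂ → ℝ}

/-- Exchange of derivatives by integrating by parts twice. -/
lemma IsAdaptedWeight.integral_swap (h : IsAdaptedWeight A₀ K φ g) (hv : ContDiff ℝ 2 v)
    {t : ℝ} (ht : t ≠ 0) (i j k : Fin 2) :
    ∫ y, g i y * secondPartial v k j (c + t • y) = ∫ y, g k y * secondPartial v i j (c + t • y) := by
  have hw := contDiff_partial hv (e j)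
  have hW := contDiff_dilation hw c t
  have e1 := integral_mul_fderiv_of_closedBall (h.support_field i) (h.contDiff_field i) hW (e k)
  have e2 := integral_mul_fderiv_of_closedBall (h.support_field k) (h.contDiff_field k) hW (e i)
  simp only [fderiv_comp_dilation hw, h.curl_free i k] at e1
  simp only [fderiv_comp_dilation hw] at e2
  rw [← e2] at e1
  simp only [mul_left_comm _ t, integral_const_mul] at e1
  exact mul_left_cancel₀ ht e1

/-- The derivative of the weighted average of `∂ₖ v` over a disk of radius proportional to `t`. -/
lemma IsAdaptedWeight.hasDerivAt_average (h : IsAdaptedWeight A₀ K φ g) (hv : ContDiff ℝ 2 v)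
    (hvs : HasCompactSupport v) (k : Fin 2) (t : ℝ) :
    HasDerivAt (fun t : ℝ => ∫ y, φ y * fderiv ℝ v (c + t • y) (e k))
      (∫ y, φ y * fderiv ℝ (fun z => fderiv ℝ v z (e k)) (c + t • y) y) t := by
  have hw := contDiff_partial hv (e k)
  have hws : HasCompactSupport (fun z => fderiv ℝ v z (e k)) := hvs.fderiv_apply ℝ _
  have hφs := hasCompactSupport_of_closedBall h.support
  have hdc : Continuous (fderiv ℝ (fun z => fderiv ℝ v z (e k))) :=
    hw.continuous_fderiv one_ne_zero
  obtain ⟨C, hC⟩ := hdc.bounded_above_of_compact_support (hws.fderiv ℝ)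
  have hφc := h.contDiff.continuous
  have hcd : ∀ t : ℝ, Continuous fun y : ℂ => c + t • y := fun t => by fun_prop
  have hcF : ∀ t : ℝ, Continuous fun y : ℂ => φ y * fderiv ℝ v (c + t • y) (e k) := fun t =>
    hφc.mul (hw.continuous.comp (hcd t))
  refine (hasDerivAt_integral_of_dominated_loc_of_deriv_le (μ := volume) (s := univ)
    (F := fun (t : ℝ) (y : ℂ) => φ y * fderiv ℝ v (c + t • y) (e k))
    (F' := fun (t : ℝ) (y : ℂ) => φ y * fderiv ℝ (fun z => fderiv ℝ v z (e k)) (c + t • y) y)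
    (bound := fun y => ‖φ y‖ * (C * ‖y‖)) univ_mem ?_ ?_ ?_ ?_ ?_ ?_).2
  · exact Eventually.of_forall fun t => (hcF t).aestronglyMeasurable
  · exact (hcF t).integrable_of_hasCompactSupport hφs.mul_right
  · exact (hφc.mul ((hdc.comp (hcd t)).clm_apply continuous_id)).aestronglyMeasurable
  · refine Eventually.of_forall fun y t _ => ?_
    rw [norm_mul]
    gcongr
    exact (ContinuousLinearMap.le_opNorm _ _).trans (by gcongr; exact hC _)
  · exact (hφc.norm.mul (by fun_prop)).integrable_of_hasCompactSupport hφs.norm.mul_right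
  · refine Eventually.of_forall fun y t _ => ?_
    have h1 : HasDerivAt (fun t : ℝ => c + t • y) y t := by
      simpa using ((hasDerivAt_id t).smul_const y).const_add c
    have h2 := ((hw.differentiable one_ne_zero (c + t • y)).hasFDerivAt).comp_hasDerivAt t h1
    exact h2.const_mul (φ y)

/-- Expanding `φ(y) y = A₀ g` gives second derivatives `∂ₖ∂ⱼv` weighted by `gᵢ`; `integral_swap`
trades `k` for `i`, so that the constant coefficient operator appears. This turns the derivative of
the average into something the differential inequality controls. -/
lemma IsAdaptedWeight.integral_radial (h : IsAdaptedWeight A₀ K φ g) (hv : ContDiff ℝ 2 v)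
    {t : ℝ} (ht : t ≠ 0) (k : Fin 2) :
    ∫ y, φ y * fderiv ℝ (fun z => fderiv ℝ v z (e k)) (c + t • y) y =
      ∑ i, ∑ j, A₀ i j * ∫ y, g k y * secondPartial v i j (c + t • y) := by
  have hint : ∀ i j l, Integrable fun y : ℂ => g i y * secondPartial v l j (c + t • y) := by
    intro i j l
    have hd : Continuous fun z => secondPartial v l j z :=
      ((contDiff_partial hv (e j)).continuous_fderiv one_ne_zero).clm_apply continuous_const
    have : Continuous fun y : ℂ => c + t • y := by fun_prop
    exact ((h.contDiff_field i).continuous.mul (hd.comp this)).integrable_of_hasCompactSupport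
      (hasCompactSupport_of_closedBall (h.support_field i)).mul_right
  have hpt : ∀ y : ℂ, φ y * fderiv ℝ (fun z => fderiv ℝ v z (e k)) (c + t • y) y =
      ∑ i, ∑ j, A₀ i j * (g i y * secondPartial v k j (c + t • y)) := by
    intro y
    have hy : y = ∑ j, (inner ℝ y (e j) : ℝ) • e j := by
      apply Complex.ext <;> simp [Fin.sum_univ_two, e, Complex.inner]
    rw [Finset.sum_comm]
    conv_lhs => rw [hy]
    rw [map_sum, Finset.mul_sum]
    refine Finset.sum_congr rfl fun j _ => ?_
    rw [← hy, map_smul, smul_eq_mul, ← mul_assoc, h.radial, Finset.sum_mul]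
    refine Finset.sum_congr rfl fun i _ => ?_
    rw [secondPartial_symm hv k j]
    simp only [secondPartial]; ring
  rw [integral_congr_ae (Eventually.of_forall hpt)]
  refine (integral_finsetSum _ fun i _ => integrable_finsetSum _ fun j _ =>
    (hint i j k).const_mul _).trans (Finset.sum_congr rfl fun i _ => ?_)
  refine (integral_finsetSum _ fun j _ => (hint i j k).const_mul _).trans ?_
  refine Finset.sum_congr rfl fun j _ => ?_
  rw [integral_const_mul, h.integral_swap hv ht i j k]

end Averages

/-! ### Interior gradient estimate for the linear operator -/

section Interior

variable {v : ℂ → ℝ} {c : ℂ} {A : ℂ → Matrix (Fin 2) (Fin 2) ℝ} {K : ℝ} {φ : ℂ → ℝ}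
  {g : Fin 2 → ℂ → ℝ}

lemma norm_e (i : Fin 2) : ‖e i‖ = 1 := by fin_cases i <;> simp [e]

/-- The derivative is moved onto `φ` at the cost of `1/t`; subtracting the constant `v c` first
leaves only the oscillation. -/
lemma IsAdaptedWeight.abs_average_le {A₀ : Matrix (Fin 2) (Fin 2) ℝ}
    (h : IsAdaptedWeight A₀ K φ g) (hK : 0 < K) (hv : ContDiff ℝ 2 v) {t m : ℝ} (ht : 0 < t)
    (hm : ∀ y ∈ closedBall (0 : ℂ) K, |v (c + t • y) - v c| ≤ m) (k : Fin 2) :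
    t * |∫ y, φ y * fderiv ℝ v (c + t • y) (e k)| ≤
      K * m * volume.real (closedBall (0 : ℂ) K) := by
  have hv1 : ContDiff ℝ 1 (fun z => v z - v c) := (hv.of_le (by norm_num)).sub contDiff_const
  have h1 := integral_mul_fderiv_of_closedBall h.support h.contDiff (contDiff_dilation hv1 c t)
    (e k)
  have hd1 : ∀ y, fderiv ℝ (fun y : ℂ => v (c + t • y) - v c) y (e k) =
      t * fderiv ℝ v (c + t • y) (e k) := fun y => by
    rw [fderiv_comp_dilation hv1 c t y (e k), fderiv_sub_const]
  simp only [hd1] at h1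
  simp only [mul_left_comm _ t, integral_const_mul] at h1
  rw [← abs_of_pos ht, ← abs_mul, abs_of_pos ht, h1, abs_neg]
  have hd : ∀ y, |fderiv ℝ φ y (e k)| ≤ K := fun y => by
    have := (fderiv ℝ φ y).le_of_opNorm_le (h.norm_fderiv_le y) (e k)
    rwa [norm_e, mul_one] at this
  refine abs_integral_le_of_closedBall (fun y hy => ?_) fun y hy => ?_
  · have : φ =ᶠ[𝓝 y] fun _ => (0 : ℝ) := by
      filter_upwards [isClosed_closedBall.isOpen_compl.mem_nhds hy] with z hz using h.support z hz
    rw [this.fderiv_eq]; simp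
  · rw [abs_mul]
    exact mul_le_mul (hd y) (hm y hy) (abs_nonneg _) hK.le

/-- Write `A(c) = A + (A(c) - A)` in `integral_radial`. The first part is `L[v]`; in the second, one
derivative is integrated onto the coefficient, so no bound for second derivatives is required. -/
lemma IsAdaptedWeight.abs_integral_radial_le (h : IsAdaptedWeight (A c) K φ g) (hK : 0 < K)
    (hv : ContDiff ℝ 2 v) (hvs : HasCompactSupport v) {t L G S : ℝ} (ht : 0 < t) (hL : 0 ≤ L)
    (hA : ∀ z ∈ closedBall c (t * K), ∀ ζ ∈ closedBall c (t * K),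
      matNorm (A z - A ζ) ≤ L * ‖ζ - z‖)
    (hG : ∀ z ∈ closedBall c (t * K), ‖fderiv ℝ v z‖ ≤ G)
    (hS : ∀ z ∈ closedBall c (t * K), |ellipticOp A v z| ≤ S) (k : Fin 2) :
    |∫ y, φ y * fderiv ℝ (fun z => fderiv ℝ v z (e k)) (c + t • y) y| ≤
      K * (S + 4 * (K + 1) * L * G) * volume.real (closedBall (0 : ℂ) K) := by
  have hmem : ∀ y ∈ closedBall (0 : ℂ) K, c + t • y ∈ closedBall c (t * K) := by
    intro y hy
    rw [mem_closedBall, dist_zero_right] at hy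
    rw [mem_closedBall, dist_eq_norm, add_sub_cancel_left, norm_smul, Real.norm_eq_abs,
      abs_of_pos ht]
    gcongr
  have hc : c ∈ closedBall c (t * K) := mem_closedBall_self (by positivity)
  set F : Fin 2 → Fin 2 → ℂ → ℝ := fun i j y => g k y * (A c i j - A (c + t • y) i j) with hF
  have hF0 : ∀ i j y, y ∉ closedBall (0 : ℂ) K → F i j y = 0 := fun i j y hy => by
    simp [hF, h.support_field k y hy]
  have hgl : ∀ y z, |g k y - g k z| ≤ K * ‖y - z‖ := fun y z =>
    convex_univ.norm_image_sub_le_of_norm_fderiv_le (𝕜 := ℝ)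
      (fun x _ => (h.contDiff_field k).differentiable one_ne_zero x)
      (fun x _ => h.norm_fderiv_field_le k x) (mem_univ z) (mem_univ y)
  -- The constant is proportional to `t`: the coefficient difference is at most `L t K` in size and
  -- `L t`-Lipschitz in `y`. This cancels the `1/t` from undoing the dilation.
  have hFl : ∀ i j, LipschitzWith (K * (L * (t * K) + L * t)).toNNReal (F i j) := by
    intro i j
    refine lipschitzWith_mul_of_closedBall hK.le (by positivity) (by positivity)
      (h.support_field k) (h.abs_field_le k) hgl (fun y hy => ?_) fun y hy z hz => ?_
    · refine (abs_entry_le_matNorm (A c - A (c + t • y)) i j).trans ((hA _ hc _ (hmem y hy)).trans ?_)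
      gcongr
      exact mem_closedBall_iff_norm.1 (hmem y hy)
    · rw [sub_sub_sub_cancel_left]
      refine (abs_entry_le_matNorm (A (c + t • z) - A (c + t • y)) i j).trans
        ((hA _ (hmem z hz) _ (hmem y hy)).trans ?_)
      rw [add_sub_add_left_eq_sub, ← smul_sub, norm_smul, Real.norm_eq_abs, abs_of_pos ht,
        mul_assoc]
  have hcD : ∀ i j, Continuous fun y : ℂ => secondPartial v i j (c + t • y) := by
    intro i j
    have hd : Continuous fun z => secondPartial v i j z :=
      ((contDiff_partial hv (e j)).continuous_fderiv one_ne_zero).clm_apply continuous_const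
    exact hd.comp (by fun_prop)
  have hFint : ∀ i j, Integrable fun y => F i j y * secondPartial v i j (c + t • y) := fun i j =>
    ((hFl i j).continuous.mul (hcD i j)).integrable_of_hasCompactSupport
      (hasCompactSupport_of_closedBall (hF0 i j)).mul_right
  have hgint : ∀ i j, Integrable fun y => g k y * secondPartial v i j (c + t • y) := fun i j =>
    ((h.contDiff_field k).continuous.mul (hcD i j)).integrable_of_hasCompactSupport
      (hasCompactSupport_of_closedBall (h.support_field k)).mul_right
  have hFb : ∀ i j, |∫ y, F i j y * secondPartial v i j (c + t • y)| ≤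
      K * (K + 1) * L * G * volume.real (closedBall (0 : ℂ) K) := by
    intro i j
    have hw := contDiff_partial hv (e j)
    have hWs : HasCompactSupport (fun y : ℂ => (fun z => fderiv ℝ v z (e j)) (c + t • y)) := by
      have h1 : HasCompactSupport (fun z => fderiv ℝ v z (e j)) := hvs.fderiv_apply ℝ _
      exact h1.comp_homeomorph ((Homeomorph.smulOfNeZero t ht.ne').trans (Homeomorph.addLeft c))
    have h1 := abs_integral_mul_fderiv_le (G := G) (hF0 i j) (hFl i j) (contDiff_dilation hw c t)
      hWs (fun y hy => by
        have := (fderiv ℝ v (c + t • y)).le_of_opNorm_le (hG _ (hmem y hy)) (e j)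
        rwa [norm_e, mul_one] at this) (e i)
    simp only [fderiv_comp_dilation hw, mul_left_comm _ t, integral_const_mul] at h1
    rw [norm_e, Real.coe_toNNReal _ (by positivity), abs_mul, abs_of_pos ht] at h1
    refine le_of_mul_le_mul_left (h1.trans_eq ?_) ht
    ring
  rw [h.integral_radial hv ht.ne' k]
  have hsplit : ∑ i, ∑ j, A c i j * ∫ y, g k y * secondPartial v i j (c + t • y) =
      (∫ y, g k y * ellipticOp A v (c + t • y)) +
        ∑ i, ∑ j, ∫ y, F i j y * secondPartial v i j (c + t • y) := by
    have h1 : ∀ y, g k y * ellipticOp A v (c + t • y) =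
        ∑ i, ∑ j, (A c i j * (g k y * secondPartial v i j (c + t • y)) -
          F i j y * secondPartial v i j (c + t • y)) := by
      intro y
      rw [ellipticOp, Finset.mul_sum]
      refine Finset.sum_congr rfl fun i _ => ?_
      rw [Finset.mul_sum]
      refine Finset.sum_congr rfl fun j _ => ?_
      simp only [hF, smul_eq_mul]; ring
    have h2 : ∫ y, g k y * ellipticOp A v (c + t • y) =
        ∑ i, ∑ j, (A c i j * (∫ y, g k y * secondPartial v i j (c + t • y)) -
          ∫ y, F i j y * secondPartial v i j (c + t • y)) := by
      rw [integral_congr_ae (Eventually.of_forall h1)]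
      refine (integral_finsetSum _ fun i _ => integrable_finsetSum _ fun j _ =>
        ((hgint i j).const_mul _).sub (hFint i j)).trans (Finset.sum_congr rfl fun i _ => ?_)
      refine (integral_finsetSum _ fun j _ => ((hgint i j).const_mul _).sub (hFint i j)).trans
        (Finset.sum_congr rfl fun j _ => ?_)
      exact (integral_sub ((hgint i j).const_mul _) (hFint i j)).trans
        (congrArg (· - _) (integral_const_mul _ _))
    rw [h2]
    simp only [Finset.sum_sub_distrib]
    ring
  rw [hsplit]
  have hSb : |∫ y, g k y * ellipticOp A v (c + t • y)| ≤
      K * S * volume.real (closedBall (0 : ℂ) K) := by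
    refine abs_integral_le_of_closedBall (fun y hy => ?_) fun y hy => ?_
    · rw [h.support_field k y hy, zero_mul]
    · rw [abs_mul]
      exact mul_le_mul (h.abs_field_le k y) (hS _ (hmem y hy)) (abs_nonneg _) hK.le
  have hsum : |∑ i, ∑ j, ∫ y, F i j y * secondPartial v i j (c + t • y)| ≤
      ∑ _i : Fin 2, ∑ _j : Fin 2, K * (K + 1) * L * G * volume.real (closedBall (0 : ℂ) K) :=
    (Finset.abs_sum_le_sum_abs _ _).trans (Finset.sum_le_sum fun i _ =>
      (Finset.abs_sum_le_sum_abs _ _).trans (Finset.sum_le_sum fun j _ => hFb i j))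
  refine (abs_add_le _ _).trans ((add_le_add hSb hsum).trans_eq ?_)
  simp only [Finset.sum_const, Finset.card_univ, Fintype.card_fin, nsmul_eq_mul]
  push_cast
  ring

/-- Interior estimate for a partial derivative at the centre of a disk. -/
lemma IsAdaptedWeight.abs_partial_le (h : IsAdaptedWeight (A c) K φ g) (hK : 0 < K)
    (hv : ContDiff ℝ 2 v) (hvs : HasCompactSupport v) {R L G S m : ℝ} (hR : 0 < R) (hL : 0 ≤ L)
    (hA : ∀ z ∈ closedBall c R, ∀ ζ ∈ closedBall c R, matNorm (A z - A ζ) ≤ L * ‖ζ - z‖)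
    (hG : ∀ z ∈ closedBall c R, ‖fderiv ℝ v z‖ ≤ G)
    (hS : ∀ z ∈ closedBall c R, |ellipticOp A v z| ≤ S)
    (hm : ∀ z ∈ closedBall c R, |v z - v c| ≤ m) (k : Fin 2) :
    |fderiv ℝ v c (e k)| ≤ K * volume.real (closedBall (0 : ℂ) K) *
      (K ^ 2 * (m / R) + R * (S + 4 * (K + 1) * L * G)) := by
  set V := volume.real (closedBall (0 : ℂ) K)
  set N : ℝ → ℝ := fun t => ∫ y, φ y * fderiv ℝ v (c + t • y) (e k) with hN
  -- Dilation by `T` maps the disk of radius `K` that carries the weight onto the disk of radius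
  -- `R`.
  set T : ℝ := R / K with hT
  have hTpos : 0 < T := by positivity
  have hTK : T * K = R := by rw [hT]; field_simp
  have hder := fun t => h.hasDerivAt_average (c := c) hv hvs k t
  obtain ⟨t, ht, hmv⟩ := exists_hasDerivAt_eq_slope N _ hTpos
    (fun t _ => (hder t).continuousAt.continuousWithinAt) (fun t _ => hder t)
  have hsub : closedBall c (t * K) ⊆ closedBall c R := by
    refine closedBall_subset_closedBall ?_
    rw [← hTK]
    exact mul_le_mul_of_nonneg_right ht.2.le hK.le
  have hD := h.abs_integral_radial_le hK hv hvs ht.1 hL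
    (fun z hz ζ hζ => hA z (hsub hz) ζ (hsub hζ)) (fun z hz => hG z (hsub hz))
    (fun z hz => hS z (hsub hz)) k
  rw [hmv, sub_zero, abs_div, abs_of_pos hTpos, div_le_iff₀ hTpos] at hD
  have hNT := h.abs_average_le (c := c) (m := m) hK hv hTpos (fun y hy => hm _ (by
    rw [mem_closedBall, dist_zero_right] at hy
    rw [mem_closedBall, dist_eq_norm, add_sub_cancel_left, norm_smul, Real.norm_eq_abs,
      abs_of_pos hTpos, ← hTK]
    gcongr)) k
  have hN0 : N 0 = fderiv ℝ v c (e k) * ∫ y, φ y := by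
    simp only [hN, zero_smul, add_zero, integral_mul_const]
    ring
  have hI := h.inv_le_integral
  have h1 : |fderiv ℝ v c (e k)| * K⁻¹ ≤ |N 0| := by
    rw [hN0, abs_mul]
    gcongr
    exact hI.trans (le_abs_self _)
  have h2 : |N T| ≤ K * m * V / T := by
    rw [le_div_iff₀ hTpos, mul_comm]; exact hNT
  have h3 : |N 0| ≤ |N T| + |N T - N 0| := by
    have := abs_sub_abs_le_abs_sub (N 0) (N T)
    rw [abs_sub_comm] at this
    linarith
  have h4 : |fderiv ℝ v c (e k)| * K⁻¹ ≤ K * m * V / T + K * (S + 4 * (K + 1) * L * G) * V * T := by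
    linarith
  rw [← div_eq_mul_inv, div_le_iff₀ hK] at h4
  refine h4.trans_eq ?_
  rw [hT]
  field_simp

end Interior

/-- Interior gradient estimate, in terms of the oscillation of the function, a bound for the
gradient, and a bound for the elliptic operator with Lipschitz coefficients. -/
theorem exists_interior_gradient_estimate {Λ : ℝ} (hΛ : 1 ≤ Λ) :
    ∃ C : ℝ, 0 < C ∧ ∀ (v : ℂ → ℝ) (c : ℂ) (A : ℂ → Matrix (Fin 2) (Fin 2) ℝ) (R L G S m : ℝ),
      ContDiff ℝ 2 v → HasCompactSupport v → 0 < R → 0 ≤ L →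
      IsEllipticLipschitz (closedBall c R) A Λ L →
      (∀ z ∈ closedBall c R, ‖fderiv ℝ v z‖ ≤ G) →
      (∀ z ∈ closedBall c R, |ellipticOp A v z| ≤ S) →
      (∀ z ∈ closedBall c R, |v z - v c| ≤ m) →
      ‖fderiv ℝ v c‖ ≤ C * (m / R + R * (S + L * G)) := by
  obtain ⟨K, hK, hex⟩ := exists_isAdaptedWeight hΛ
  set V := volume.real (closedBall (0 : ℂ) K) with hV
  set P : ℝ := K ^ 2 + 4 * (K + 1) with hP
  have hV0 : 0 ≤ V := measureReal_nonneg
  refine ⟨2 * (K * V * P) + 1, by positivity, ?_⟩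
  intro v c A R L G S m hv hvs hR hL hA hG hS hm
  have hc : c ∈ closedBall c R := mem_closedBall_self hR.le
  obtain ⟨φ, g, h⟩ := hex (A c) (hA.symm c hc) (hA.elliptic c hc)
  have hG0 : 0 ≤ G := (norm_nonneg _).trans (hG c hc)
  have hS0 : 0 ≤ S := (abs_nonneg _).trans (hS c hc)
  have hm0 : 0 ≤ m := (abs_nonneg _).trans (hm c hc)
  have hpart : ∀ k, |fderiv ℝ v c (e k)| ≤ K * V * P * (m / R + R * (S + L * G)) := by
    intro k
    refine (h.abs_partial_le hK hv hvs hR hL hA.lipschitz hG hS hm k).trans ?_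
    rw [mul_assoc (K * V)]
    gcongr
    have e1 : K ^ 2 ≤ P := by rw [hP]; nlinarith
    have e2 : 4 * (K + 1) ≤ P := by rw [hP]; nlinarith [sq_nonneg K]
    have e3 : 1 ≤ P := by nlinarith
    have hmR : 0 ≤ m / R := by positivity
    have e4 : S + 4 * (K + 1) * L * G ≤ P * (S + L * G) := by
      have : 4 * (K + 1) * (L * G) ≤ P * (L * G) := by gcongr
      nlinarith
    calc K ^ 2 * (m / R) + R * (S + 4 * (K + 1) * L * G)
        ≤ P * (m / R) + R * (P * (S + L * G)) := by gcongr
      _ = _ := by ring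
  have hX : 0 ≤ m / R + R * (S + L * G) := by positivity
  refine ContinuousLinearMap.opNorm_le_bound _ (by positivity) fun z => ?_
  have hz : z = z.re • e 0 + z.im • e 1 := by apply Complex.ext <;> simp [e]
  conv_lhs => rw [hz]
  rw [map_add, map_smul, map_smul, Real.norm_eq_abs, smul_eq_mul, smul_eq_mul]
  calc _ ≤ |z.re| * |fderiv ℝ v c (e 0)| + |z.im| * |fderiv ℝ v c (e 1)| := by
        rw [← abs_mul, ← abs_mul]; exact abs_add_le _ _
    _ ≤ ‖z‖ * (K * V * P * (m / R + R * (S + L * G))) +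
        ‖z‖ * (K * V * P * (m / R + R * (S + L * G))) := by
      gcongr
      · exact Complex.abs_re_le_norm z
      · exact hpart 0
      · exact Complex.abs_im_le_norm z
      · exact hpart 1
    _ ≤ _ := by nlinarith [mul_nonneg hX (norm_nonneg z)]

/-! ### Real or complex valued functions in a domain -/

variable {𝕜 : Type*} [RCLike 𝕜]

lemma IsEllipticLipschitz.mono {D E : Set ℂ} {A : ℂ → Matrix (Fin 2) (Fin 2) ℝ} {Λ L : ℝ}
    (h : IsEllipticLipschitz D A Λ L) (hE : E ⊆ D) : IsEllipticLipschitz E A Λ L :=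
  ⟨fun z hz => h.symm z (hE hz), fun z hz => h.elliptic z (hE hz),
    fun z hz ζ hζ => h.lipschitz z (hE hz) ζ (hE hζ)⟩

lemma ellipticOp_eq_of_eventuallyEq {A : ℂ → Matrix (Fin 2) (Fin 2) ℝ} {u : ℂ → 𝕜} {v : ℂ → ℝ}
    {z : ℂ} (ℓ : 𝕜 →L[ℝ] ℝ) (hu : ContDiffAt ℝ 2 u z) (hv : v =ᶠ[𝓝 z] fun w => ℓ (u w)) :
    ellipticOp A v z = ℓ (ellipticOp A u z) := by
  have h2 : ∀ i j, secondPartial v i j z = ℓ (secondPartial u i j z) := by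
    intro i j
    have h1 : (fun w => fderiv ℝ v w (e j)) =ᶠ[𝓝 z] fun w => ℓ (fderiv ℝ u w (e j)) := by
      filter_upwards [hv.eventuallyEq_nhds, hu.eventually (by simp)] with w hw huw
      rw [hw.fderiv_eq]
      have := (ℓ.hasFDerivAt.comp w (huw.differentiableAt (by norm_num)).hasFDerivAt).fderiv
      exact congrArg (fun T => T (e j)) this
    have hd : DifferentiableAt ℝ (fun w => fderiv ℝ u w (e j)) z :=
      ((hu.fderiv_right (m := 1) (by norm_num)).differentiableAt one_ne_zero).clm_apply
        (differentiableAt_const _)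
    unfold secondPartial
    rw [h1.fderiv_eq]
    exact congrArg (fun T => T (e i)) (ℓ.hasFDerivAt.comp z hd.hasFDerivAt).fderiv
  simp only [ellipticOp, h2, map_sum, map_smul]

/-- A `C²` function near a closed disk agrees there with a compactly supported one. -/
lemma exists_compactlySupported_extension {D : Set ℂ} {v : ℂ → ℝ} (hv : ContDiffOn ℝ 2 v D)
    (hD : IsOpen D) {c : ℂ} {R R' : ℝ} (hR : 0 < R) (hRR : R < R') (hsub : closedBall c R' ⊆ D) :
    ∃ w : ℂ → ℝ, ContDiff ℝ 2 w ∧ HasCompactSupport w ∧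
      ∀ z ∈ closedBall c R, w =ᶠ[𝓝 z] v := by
  let χ : ContDiffBump c := ⟨(R + R') / 2, R', by linarith, by linarith⟩
  refine ⟨fun z => χ z * v z, contDiff_iff_contDiffAt.2 fun z => ?_,
    χ.hasCompactSupport.mul_right, fun z hz => ?_⟩
  · by_cases hz : z ∈ closedBall c R'
    · exact χ.contDiffAt.mul (hv.contDiffAt (hD.mem_nhds (hsub hz)))
    · have : (fun z => χ z * v z) =ᶠ[𝓝 z] fun _ => (0 : ℝ) := by
        filter_upwards [isClosed_closedBall.isOpen_compl.mem_nhds hz] with y hy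
        rw [mem_compl_iff, mem_closedBall, not_le] at hy
        rw [χ.zero_of_le_dist hy.le, zero_mul]
      exact contDiffAt_const.congr_of_eventuallyEq this
  · have : z ∈ ball c ((R + R') / 2) := closedBall_subset_ball (by linarith) hz
    filter_upwards [isOpen_ball.mem_nhds this] with y hy
    rw [χ.one_of_mem_closedBall (ball_subset_closedBall hy), one_mul]

/-- The interior gradient estimate for real or complex valued functions in a domain. -/
theorem exists_gradNorm_estimate (𝕜 : Type*) [RCLike 𝕜] {Λ : ℝ} (hΛ : 1 ≤ Λ) :
    ∃ C : ℝ, 0 < C ∧ ∀ (D : Set ℂ) (u : ℂ → 𝕜) (c : ℂ) (A : ℂ → Matrix (Fin 2) (Fin 2) ℝ)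
      (R R' L G S m : ℝ), IsOpen D → ContDiffOn ℝ 2 u D → 0 < R → R < R' → closedBall c R' ⊆ D →
      0 ≤ L → IsEllipticLipschitz D A Λ L →
      (∀ z ∈ closedBall c R, gradNorm u z ≤ G) →
      (∀ z ∈ closedBall c R, ‖ellipticOp A u z‖ ≤ S) →
      (∀ z ∈ closedBall c R, ‖u z - u c‖ ≤ m) →
      gradNorm u c ≤ C * (m / R + R * (S + L * G)) := by
  obtain ⟨C, hC, hest⟩ := exists_interior_gradient_estimate hΛ
  refine ⟨C, hC, ?_⟩
  intro D u c A R R' L G S m hD hu hR hRR hsub hL hA hG hS hm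
  have hsubR : closedBall c R ⊆ D := (closedBall_subset_closedBall hRR.le).trans hsub
  have hc : c ∈ closedBall c R := mem_closedBall_self hR.le
  have hG0 : 0 ≤ G := (norm_nonneg _).trans (hG c hc)
  have hS0 : 0 ≤ S := (norm_nonneg _).trans (hS c hc)
  have hm0 : 0 ≤ m := (norm_nonneg _).trans (hm c hc)
  have hcd : ∀ z ∈ closedBall c R, ContDiffAt ℝ 2 u z := fun z hz =>
    hu.contDiffAt (hD.mem_nhds (hsubR hz))
  refine ContinuousLinearMap.opNorm_le_bound _ (by positivity) fun h => ?_
  -- A real functional of norm at most one that attains `‖fderiv ℝ u c h‖` reduces the claim to the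
  -- scalar function `ℓ ∘ u`; the operator commutes with `ℓ`.
  obtain ⟨ℓ, hℓ1, hℓ⟩ := exists_dual_vector'' ℝ (fderiv ℝ u c h)
  obtain ⟨v, hv, hvs, hveq⟩ := exists_compactlySupported_extension
    (v := fun z => ℓ (u z)) (ℓ.contDiff.comp_contDiffOn hu) hD hR hRR hsub
  have hℓle : ∀ x, |ℓ x| ≤ ‖x‖ := fun x => by
    simpa using ℓ.le_of_opNorm_le hℓ1 x
  have hfd : ∀ z ∈ closedBall c R, fderiv ℝ v z = ℓ.comp (fderiv ℝ u z) := fun z hz => by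
    rw [(hveq z hz).fderiv_eq]
    exact (ℓ.hasFDerivAt.comp z ((hcd z hz).differentiableAt (by norm_num)).hasFDerivAt).fderiv
  have key := hest v c A R L G S m hv hvs hR hL (hA.mono hsubR)
    (fun z hz => by
      rw [hfd z hz]
      refine (ContinuousLinearMap.opNorm_comp_le _ _).trans (le_trans ?_ (hG z hz))
      exact mul_le_of_le_one_left (norm_nonneg _) hℓ1)
    (fun z hz => by
      rw [ellipticOp_eq_of_eventuallyEq ℓ (hcd z hz) (hveq z hz)]
      exact (hℓle _).trans (hS z hz))
    (fun z hz => by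
      rw [(hveq z hz).eq_of_nhds, (hveq c hc).eq_of_nhds, ← map_sub]
      exact (hℓle _).trans (hm z hz))
  calc ‖fderiv ℝ u c h‖ = ‖fderiv ℝ v c h‖ := by
        rw [hfd c hc, ContinuousLinearMap.comp_apply, hℓ]; simp
    _ ≤ _ := (fderiv ℝ v c).le_of_opNorm_le key h

/-! ### Absorbing the quadratic gradient term -/

/-- Absorption of the quadratic term: smallness of the oscillation forces `Q ≤ 1`, and then the
estimate becomes linear. -/
lemma le_of_quadratic_estimate {C B Γ L δ Q s r : ℝ} (hC : 0 < C) (hB : 0 ≤ B) (hΓ : 0 ≤ Γ)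
    (hL : 0 ≤ L) (hδ : 0 < δ) (hδ2 : δ ≤ 1 / 2) (hδC : C * δ * (2 * L + 4 * B + Γ) ≤ 1 / 4)
    (hr1 : r ^ 2 ≤ 1) (hs : 0 ≤ s)
    (hε : ∀ t, 0 < t → t ≤ 1 / 2 →
      Q ≤ C * (δ / (4 * C) / t + t * (Γ * r ^ 2 + 4 * B * Q ^ 2 + 2 * L * Q)))
    (hsup : ∀ t, 0 < t → t ≤ 1 / 2 →
      Q ≤ C * (2 * s / t + t * (Γ * r ^ 2 + 4 * B * Q ^ 2 + 2 * L * Q))) (hQ : 0 ≤ Q) :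
    Q ≤ 4 * C / δ * s + r ^ 2 := by
  have hQ1 : Q ≤ 1 := by
    by_contra! hlt
    have hQ0 : 0 < Q := by linarith
    -- With `t = δ/Q` both `1/t` and `t Q²` are linear in `Q`: each of the two terms is at most
    -- `Q/4`, which is impossible for `Q > 0`.
    have h := hε (δ / Q) (by positivity) ((div_le_self hδ.le hlt.le).trans hδ2)
    have e1 : C * (δ / (4 * C) / (δ / Q) + δ / Q * (Γ * r ^ 2 + 4 * B * Q ^ 2 + 2 * L * Q)) =
        Q / 4 + C * δ * (Γ * (r ^ 2 / Q) + 4 * B * Q + 2 * L) := by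
      field_simp
    rw [e1] at h
    have h2 : r ^ 2 / Q ≤ Q := by
      rw [div_le_iff₀ hQ0]; nlinarith
    have h3 : C * δ * (Γ * (r ^ 2 / Q) + 4 * B * Q + 2 * L) ≤
        C * δ * (Γ * Q + 4 * B * Q + 2 * L * Q) := by
      refine mul_le_mul_of_nonneg_left ?_ (by positivity)
      nlinarith [mul_le_mul_of_nonneg_left h2 hΓ, mul_le_mul_of_nonneg_left hlt.le hL]
    have h4 : C * δ * (Γ * Q + 4 * B * Q + 2 * L * Q) ≤ 1 / 4 * Q := by
      calc _ = C * δ * (2 * L + 4 * B + Γ) * Q := by ring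
        _ ≤ _ := by gcongr
    linarith
  have h := hsup δ hδ hδ2
  have hCδ : 0 ≤ C * δ := by positivity
  have h1 : C * δ * (4 * B * Q ^ 2) ≤ C * δ * (4 * B * Q) := by
    gcongr; nlinarith
  have h2 : C * δ * (4 * B + 2 * L) ≤ 1 / 4 := by
    refine le_trans (mul_le_mul_of_nonneg_left ?_ hCδ) hδC
    linarith
  have h3 : C * δ * Γ ≤ 1 / 4 := by
    refine le_trans (mul_le_mul_of_nonneg_left ?_ hCδ) hδC
    linarith
  have h4 := mul_le_mul_of_nonneg_right h2 hQ
  have h5 := mul_le_mul_of_nonneg_right h3 (sq_nonneg r)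
  have e2 : C * (2 * s / δ) = 1 / 2 * (4 * C / δ * s) := by field_simp; ring
  have h6 : 0 ≤ 4 * C / δ * s := by positivity
  have h7 : Q ≤ 1 / 2 * (4 * C / δ * s) + (C * δ * Γ * r ^ 2 + C * δ * (4 * B * Q ^ 2) +
      C * δ * (2 * L * Q)) := by
    rw [← e2]; refine h.trans_eq ?_; ring
  nlinarith

/-- The gradient estimate at the centre of a small disk on which `u` has small oscillation. -/
theorem exists_gradNorm_center_estimate (𝕜 : Type*) [RCLike 𝕜] {Λ L B Γ : ℝ} (hΛ : 1 ≤ Λ)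
    (hL : 0 ≤ L) (hB : 0 ≤ B) (hΓ : 0 ≤ Γ) :
    ∃ ε : ℝ, 0 < ε ∧ ∃ C : ℝ, 0 < C ∧ ∀ (D : Set ℂ) (A : ℂ → Matrix (Fin 2) (Fin 2) ℝ)
      (u : ℂ → 𝕜) (z₀ : ℂ) (r s : ℝ), IsOpen D → IsEllipticLipschitz D A Λ L →
      IsSolution D A B Γ u → 0 < r → r ≤ 1 → closedBall z₀ r ⊆ D →
      (∀ z ∈ closedBall z₀ r, ∀ w ∈ closedBall z₀ r, ‖u z - u w‖ ≤ ε) →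
      (∀ z ∈ closedBall z₀ r, ‖u z‖ ≤ s) →
      r * gradNorm u z₀ ≤ C * s + r ^ 2 := by
  obtain ⟨C, hC, hest⟩ := exists_gradNorm_estimate 𝕜 hΛ
  set δ : ℝ := min (1 / 2) (1 / (4 * C * (2 * L + 4 * B + Γ + 1))) with hδdef
  have hδ : 0 < δ := lt_min (by norm_num) (by positivity)
  have hδC : C * δ * (2 * L + 4 * B + Γ) ≤ 1 / 4 := by
    calc C * δ * (2 * L + 4 * B + Γ) ≤
        C * (1 / (4 * C * (2 * L + 4 * B + Γ + 1))) * (2 * L + 4 * B + Γ + 1) := by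
          refine mul_le_mul (mul_le_mul_of_nonneg_left (min_le_right _ _) hC.le) (by linarith)
            (by positivity) (by positivity)
      _ = 1 / 4 := by field_simp
  refine ⟨δ / (4 * C), by positivity, 4 * C / δ, by positivity, ?_⟩
  intro D A u z₀ r s hD hA hu hr hr1 hsub hε hsup
  have hgc : ContinuousOn (gradNorm u) (closedBall z₀ r) :=
    ((hu.contDiffOn.continuousOn_fderiv_of_isOpen hD (by norm_num)).norm).mono hsub
  have hz₀ : z₀ ∈ closedBall z₀ r := mem_closedBall_self hr.le
  obtain ⟨z₁, hz₁, hmax⟩ := (isCompact_closedBall z₀ r).exists_isMaxOn ⟨z₀, hz₀⟩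
    (f := fun z => (r - dist z z₀) * gradNorm u z)
    ((continuousOn_const.sub (continuous_id.dist continuous_const).continuousOn).mul hgc)
  set d₁ : ℝ := r - dist z₁ z₀ with hd₁
  set Q : ℝ := d₁ * gradNorm u z₁ with hQ
  have hs : 0 ≤ s := (norm_nonneg _).trans (hsup z₀ hz₀)
  have hle : r * gradNorm u z₀ ≤ Q := by simpa using hmax hz₀
  have hg0 : 0 ≤ gradNorm u z₁ := norm_nonneg _
  have hd0 : 0 ≤ d₁ := sub_nonneg.2 hz₁
  have hd1 : d₁ ≤ r := by rw [hd₁]; linarith [dist_nonneg (x := z₁) (y := z₀)]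
  have hQ0 : 0 ≤ Q := mul_nonneg hd0 hg0
  refine hle.trans ?_
  rcases hd0.eq_or_lt with h0 | hdpos
  · rw [hQ, ← h0, zero_mul]; positivity
  -- The estimate on the disk of radius `t d₁` about `z₁`, multiplied by `d₁`. As `t ≤ 1/2`, half
  -- the distance to the circle remains, so maximality gives `|∇u| ≤ 2 |∇u(z₁)|` there; the radius
  -- `3/4 * d₁` leaves room for the cut-off.
  have key : ∀ m t : ℝ, 0 < t → t ≤ 1 / 2 →
      (∀ z ∈ closedBall z₀ r, ‖u z - u z₁‖ ≤ m) →
      Q ≤ C * (m / t + t * (Γ * r ^ 2 + 4 * B * Q ^ 2 + 2 * L * Q)) := by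
    intro m t ht ht2 hm
    have htd : t * d₁ ≤ d₁ / 2 := by nlinarith
    have hball : closedBall z₁ (3 / 4 * d₁) ⊆ closedBall z₀ r :=
      closedBall_subset_closedBall' (by rw [hd₁]; linarith)
    have hball2 : closedBall z₁ (t * d₁) ⊆ closedBall z₀ r :=
      (closedBall_subset_closedBall (by linarith)).trans hball
    have hG : ∀ z ∈ closedBall z₁ (t * d₁), gradNorm u z ≤ 2 * gradNorm u z₁ := by
      intro z hz
      have h1 : (r - dist z z₀) * gradNorm u z ≤ Q := hmax (hball2 hz)
      have h2 : d₁ / 2 ≤ r - dist z z₀ := by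
        have := dist_triangle z z₁ z₀
        rw [mem_closedBall] at hz
        rw [hd₁] at htd hz ⊢; linarith
      have h3 : d₁ / 2 * gradNorm u z ≤ Q :=
        (mul_le_mul_of_nonneg_right h2 (norm_nonneg _)).trans h1
      rw [hQ] at h3
      nlinarith
    have h := hest D u z₁ A (t * d₁) (3 / 4 * d₁) L (2 * gradNorm u z₁)
      (B * (2 * gradNorm u z₁) ^ 2 + Γ) m hD hu.contDiffOn (by positivity) (by linarith)
      (hball.trans hsub) hL hA hG
      (fun z hz => (hu.ineq z (hsub (hball2 hz))).trans (by
        have := hG z hz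
        have h0 : 0 ≤ gradNorm u z := norm_nonneg _
        gcongr))
      (fun z hz => hm z (hball2 hz))
    calc Q ≤ d₁ * (C * (m / (t * d₁) + t * d₁ *
          (B * (2 * gradNorm u z₁) ^ 2 + Γ + L * (2 * gradNorm u z₁)))) := by
          rw [hQ]; gcongr
      _ = C * (m / t + t * (Γ * d₁ ^ 2 + 4 * B * Q ^ 2 + 2 * L * (d₁ * Q))) := by
          rw [hQ]; field_simp; ring
      _ ≤ _ := by
          gcongr
          exact mul_le_of_le_one_left hQ0 (hd1.trans hr1)
  refine le_of_quadratic_estimate hC hB hΓ hL hδ (min_le_left _ _) hδC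
    (pow_le_one₀ hr.le hr1) hs (fun t ht ht2 => key _ t ht ht2 fun z hz => hε z hz z₁ hz₁)
    (fun t ht ht2 => key _ t ht ht2 fun z hz => ?_) hQ0
  calc ‖u z - u z₁‖ ≤ ‖u z‖ + ‖u z₁‖ := norm_sub_le _ _
    _ ≤ 2 * s := by linarith [hsup z hz, hsup z₁ hz₁]

/-! ### Distance to the boundary and the final choice of the disk -/

lemma bdryDist_pos {D : Set ℂ} (hD : IsOpen D) (hb : Bornology.IsBounded D) {z : ℂ} (hz : z ∈ D) :
    0 < bdryDist D z ∧ bdryDist D z ≤ diam D := by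
  have hne : (frontier D).Nonempty := by
    refine nonempty_frontier_iff.2 ⟨⟨z, hz⟩, fun h => ?_⟩
    rw [h] at hb
    exact NormedSpace.unbounded_univ ℝ ℂ hb
  refine ⟨(isClosed_frontier.notMem_iff_infDist_pos hne).1 fun h => ?_, ?_⟩
  · rw [hD.frontier_eq] at h
    exact h.2 hz
  · obtain ⟨p, hp⟩ := hne
    refine (infDist_le_dist_of_mem hp).trans ?_
    rw [← diam_closure D]
    exact dist_le_diam_of_mem hb.closure (subset_closure hz) (frontier_subset_closure hp)

/-- A disk is connected, so leaving `D` would force it to meet the frontier, at distance less than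
`bdryDist D z`. -/
lemma ball_bdryDist_subset {D : Set ℂ} (hD : IsOpen D) {z : ℂ} (hz : z ∈ D) : ball z (bdryDist D z) ⊆ D := by
  rcases le_or_gt (bdryDist D z) 0 with h0 | h0
  · rw [ball_eq_empty.2 h0]; exact empty_subset D
  refine (convex_ball z _).isPreconnected.subset_of_closure_inter_subset hD
    ⟨z, mem_ball_self h0, hz⟩ fun p hp => ?_
  by_contra hpD
  have hpf : p ∈ frontier D := by
    rw [hD.frontier_eq]; exact ⟨hp.1, hpD⟩
  have := infDist_le_dist_of_mem (x := z) hpf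
  have hlt := hp.2
  rw [mem_ball, dist_comm] at hlt
  exact absurd hlt (not_lt.2 this)

end EllipticPlane

end

theorem theorem2p1 {𝕜 : Type*} [RCLike 𝕜] (ω : ℝ → ℝ) (Λ 𝔏 B Γ M d : ℝ)
    (hΛ : 1 ≤ Λ) (h𝔏 : 0 ≤ 𝔏) (hB : 0 ≤ B) (hΓ : 0 ≤ Γ) :
    ∃ C₀ C₁ : ℝ, ∀ (D : Set ℂ) (A : ℂ → Matrix (Fin 2) (Fin 2) ℝ) (u : ℂ → 𝕜),
      IsOpen D → IsConnected D → Bornology.IsBounded D → Metric.diam D = d →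
      EllipticPlane.IsEllipticLipschitz D A Λ 𝔏 →
      EllipticPlane.IsSolution D A B Γ u →
      (∀ z ∈ D, ‖u z‖ ≤ M) →
      EllipticPlane.IsModulusOfContinuity D u ω →
      ∀ z ∈ D, EllipticPlane.gradNorm u z <
        C₀ * (EllipticPlane.bdryDist D z)⁻¹ * EllipticPlane.diskSup D u z + C₁ := by
  obtain ⟨ε, hε, C, hC, hest⟩ :=
    EllipticPlane.exists_gradNorm_center_estimate 𝕜 hΛ h𝔏 hB hΓ
  by_cases hω : Tendsto ω (𝓝[>] 0) (𝓝 0)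
  swap
  · exact ⟨0, 0, fun D A u _ _ _ _ _ _ _ hmod => absurd hmod.tendsto hω⟩
  obtain ⟨η, hη, hηω⟩ : ∃ η : ℝ, 0 < η ∧ ∀ t, 0 < t → t < η → ω t ≤ ε := by
    have h := hω.eventually (gt_mem_nhds hε)
    rw [eventually_nhdsWithin_iff, Metric.eventually_nhds_iff] at h
    obtain ⟨η, hη, h⟩ := h
    exact ⟨η, hη, fun t ht htη => (h (by
      rw [Real.dist_eq, sub_zero, abs_of_pos ht]; exact htη) ht).le⟩
  -- As `ρ ≤ d`, the radius `κ ρ` is at most `min η 1 / 4`: points of the disk are less than `η`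
  -- apart, so the oscillation is at most `ε`, with `κ` independent of `D`.
  set κ : ℝ := min (1 / 2) (min η 1 / (4 * (|d| + 1))) with hκ
  have hη1 : 0 < min η 1 := lt_min hη one_pos
  have hκ0 : 0 < κ := lt_min (by norm_num) (by positivity)
  -- Division by `κ ρ` leaves the additive term `κ ρ ≤ 1/4`; the constant `2` makes the inequality
  -- strict.
  refine ⟨C / κ, 2, fun D A u hD _ hb hd hA hu hM hmod z hz => ?_⟩
  obtain ⟨hρ0, hρd⟩ := EllipticPlane.bdryDist_pos hD hb hz
  set ρ := EllipticPlane.bdryDist D z with hρ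
  rw [hd] at hρd
  set s := EllipticPlane.diskSup D u z with hs
  have hr : κ * ρ ≤ min η 1 / 4 := by
    calc κ * ρ ≤ min η 1 / (4 * (|d| + 1)) * (|d| + 1) := by
          gcongr
          · exact min_le_right _ _
          · linarith [le_abs_self d]
      _ = _ := by field_simp
  have hrρ : κ * ρ < ρ := by
    have : κ ≤ 1 / 2 := min_le_left _ _
    nlinarith
  have hsub : closedBall z (κ * ρ) ⊆ D :=
    (closedBall_subset_ball hrρ).trans (EllipticPlane.ball_bdryDist_subset hD hz)
  have h := hest D A u z (κ * ρ) s hD hA hu (by positivity)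
    (by linarith [min_le_right η 1]) hsub
    (fun x hx y hy => by
      by_cases hxy : x = y
      · rw [hxy, sub_self, norm_zero]; exact hε.le
      · refine (hmod.bound x (hsub hx) y (hsub hy) hxy).trans
          (hηω _ (norm_pos_iff.2 (sub_ne_zero.2 hxy)) ?_)
        rw [← dist_eq_norm]
        have := dist_triangle_right x y z
        rw [mem_closedBall] at hx hy
        linarith [min_le_left η 1])
    (fun x hx => by
      refine le_csSup ⟨M, ?_⟩ ⟨x, ⟨hsub hx, ?_⟩, rfl⟩
      · rintro _ ⟨y, hy, rfl⟩
        exact hM y hy.1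
      · rw [← dist_eq_norm]
        exact (mem_closedBall.1 hx).trans hrρ.le)
  have hr0 : 0 < κ * ρ := by positivity
  have h2 : EllipticPlane.gradNorm u z ≤ C / κ * ρ⁻¹ * s + κ * ρ := by
    refine le_of_mul_le_mul_left (h.trans_eq ?_) hr0
    field_simp
  linarith [min_le_right η 1]
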